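/- Let $\Gamma$ be a divisible totally ordered abelian group, $v\colon F\to\Gamma\cup\{\infty\}$ a valuation on a field $F$ with value group $\Gamma_F=v(F^\times)$, and $(F_h,v_h)$ a Henselization of $(F,v)$, with $v_h$ taking values in $\Gamma\cup\{\infty\}$. Let $V$ be a finite-dimensional $F$-vector space, identified with its image in $V\otimes_F F_h$. For a valued field $(K,u)$ with $u\colon K\to G\cup\{\infty\}$, a $u$-norm on a finite-dimensional $K$-vector space $W$ is a map $\alpha\colon W\to G\cup\{\infty\}$ such that $\alpha(x)=\infty$ if and only if $x=0$, $\alpha(x+y)\ge\min(\alpha(x),\alpha(y))$, and $\alpha(xc)=\alpha(x)+u(c)$ for all $x,y\in W$, $c\in K$, and such that $W$ has a base $(e_i)$ (a splitting base) with $\alpha(\sum e_ic_i)=\min_i\alpha(e_ic_i)$ for all $c_i\in K$. If $(K',u')$ is a valued field extension of $(K,u)$, then $\alpha\otimes u'$ denotes the $u'$-norm on $W\otimes_K K'$ given by $(\alpha\otimes u')(\sum e_i\otimes k_i)=\min_i(\alpha(e_i)+u'(k_i))$, for any splitting base $(e_i)$ of $W$ for $\alpha$ (it does not depend on the choice of the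 base). The rank of an ordered abelian group is the number of its convex subgroups different from the group itself. Inside $\Gamma$, the divisible hull $\Gamma_F\otimes_{\mathbb Z}\mathbb Q$ is $\{\gamma\in\Gamma : n\gamma\in\Gamma_F \text{ for some integer } n\ge 1\}$. Let $\alpha\colon V\otimes_F F_h\to\Gamma\cup\{\infty\}$ be a $v_h$-norm. (1) Suppose that $\Gamma=\Gamma_F\otimes_{\mathbb Z}\mathbb Q$, and let $\Delta\subseteq\Gamma$ be a convex subgroup of rank $1$, with canonical map $\varepsilon\colon\Gamma\to\Lambda=\Gamma/\Delta$ (where $\Lambda$ carries the induced ordering, and $\varepsilon(\infty)=\infty$). Put $w=\varepsilon\circ v$, $y=\varepsilon\circ v_h$ and $\beta=\varepsilon\circ\alpha$. If $\beta|_V$ is a $w$-norm and $\beta=\beta|_V\otimes y$, then $\alpha|_V$ is a $v$-norm on $V$ and $\alpha=\alpha|_V\otimes v_h$. (2) If $\Gamma_F$ has rank $1$, and if there is $\gamma\in\Gamma$ such that $\alpha(x)\in\gamma+(\Gamma_F\otimes_{\mathbb Z}\mathbb Q)$ for all nonzero $x\in V\otimes_F F_h$, then $\alpha|_V$ is a $v$-norm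 on $V$ and $\alpha=\alpha|_V\otimes v_h$. -/

import Mathlib

open scoped TensorProduct

universe u

namespace NormDescent

section OrderedGroups

/-- A convex subgroup of an ordered abelian group. -/
@[ext]
structure ConvexSubgroup (G : Type*) [AddCommGroup G] [LinearOrder G] extends AddSubgroup G where
  convex' : ∀ a b : G, 0 ≤ a → a ≤ b → b ∈ carrier → a ∈ carrier

/-- The rank of an ordered abelian group: the number (possibly infinite) of its convex subgroups
other than the whole group. -/
noncomputable def rank (G : Type*) [AddCommGroup G] [LinearOrder G] : ℕ∞ :=
  Set.encard {H : ConvexSubgroup G | H.toAddSubgroup ≠ ⊤}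

variable {Γ : Type*} [AddCommGroup Γ] [LinearOrder Γ]

/-- The elements of `Γ` having a nonzero multiple in `H`. If `Γ` is divisible, this is the
divisible hull `H ⊗ ℚ` of `H`, viewed inside `Γ`. -/
def divisibleHull (H : AddSubgroup Γ) : AddSubgroup Γ where
  carrier := {γ | ∃ n : ℕ, 0 < n ∧ n • γ ∈ H}
  zero_mem' := ⟨1, one_pos, by simp⟩
  add_mem' := by
    rintro a b ⟨m, hm, ha⟩ ⟨n, hn, hb⟩
    refine ⟨m * n, Nat.mul_pos hm hn, ?_⟩
    rw [smul_add, mul_comm, mul_smul, mul_comm, mul_smul]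
    exact H.add_mem (H.nsmul_mem ha n) (H.nsmul_mem hb m)
  neg_mem' := by
    rintro a ⟨n, hn, ha⟩
    exact ⟨n, hn, by rw [smul_neg]; exact H.neg_mem ha⟩

namespace ConvexSubgroup

variable (Δ : ConvexSubgroup Γ)

/-- The quotient group `Λ = Γ / Δ`. -/
def Quo : Type _ := Γ ⧸ Δ.toAddSubgroup

instance : AddCommGroup Δ.Quo := inferInstanceAs (AddCommGroup (Γ ⧸ Δ.toAddSubgroup))

/-- The canonical map `ε : Γ → Γ / Δ`. -/
def ε : Γ →+ Δ.Quo := QuotientAddGroup.mk' Δ.toAddSubgroup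

theorem ε_surjective : Function.Surjective Δ.ε := QuotientAddGroup.mk'_surjective _

theorem ε_eq_iff (a b : Γ) : Δ.ε a = Δ.ε b ↔ -a + b ∈ Δ.toAddSubgroup := QuotientAddGroup.eq

/-- The ordering induced by that of `Γ`: `p ≤ q` if and only if `p = ε a`, `q = ε b` for some
`a ≤ b`. -/
instance : LE Δ.Quo := ⟨fun p q => ∃ a b : Γ, Δ.ε a = p ∧ Δ.ε b = q ∧ a ≤ b⟩

theorem ε_le_ε {a b : Γ} (h : a ≤ b) : Δ.ε a ≤ Δ.ε b := ⟨a, b, rfl, rfl, h⟩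

variable [IsOrderedAddMonoid Γ]

theorem ε_le_iff (a b : Γ) : Δ.ε a ≤ Δ.ε b ↔ ∃ d ∈ Δ.toAddSubgroup, a ≤ b + d := by
  constructor
  · rintro ⟨a', b', ha, hb, h⟩
    rw [ε_eq_iff] at ha hb
    refine ⟨(-a' + a) + -(-b' + b), Δ.add_mem ha (Δ.neg_mem hb), ?_⟩
    have h2 : b + ((-a' + a) + -(-b' + b)) = a + (b' - a') := by abel
    rw [h2]
    exact le_add_of_nonneg_right (sub_nonneg.2 h)
  · rintro ⟨d, hd, h⟩
    exact ⟨a, b + d, rfl, by rw [ε_eq_iff]; simpa using Δ.neg_mem hd, h⟩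

open Classical in
noncomputable instance : LinearOrder Δ.Quo where
  le_refl p := by
    obtain ⟨a, rfl⟩ := Δ.ε_surjective p
    exact Δ.ε_le_ε le_rfl
  le_trans p q r := by
    obtain ⟨a, rfl⟩ := Δ.ε_surjective p
    obtain ⟨b, rfl⟩ := Δ.ε_surjective q
    obtain ⟨c, rfl⟩ := Δ.ε_surjective r
    simp only [ε_le_iff]
    rintro ⟨d, hd, h⟩ ⟨d', hd', h'⟩
    refine ⟨d' + d, Δ.add_mem hd' hd, h.trans ?_⟩
    rw [← add_assoc]
    exact add_le_add_left h' d
  le_antisymm p q := by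
    obtain ⟨a, rfl⟩ := Δ.ε_surjective p
    obtain ⟨b, rfl⟩ := Δ.ε_surjective q
    simp only [ε_le_iff, ε_eq_iff]
    rintro ⟨d, hd, h⟩ ⟨d', hd', h'⟩
    rcases le_total 0 (-a + b) with h0 | h0
    · exact Δ.convex' _ d' h0 (by rw [neg_add_le_iff_le_add]; exact h') hd'
    · have h1 : -(-a + b) ∈ Δ.toAddSubgroup :=
        Δ.convex' _ d (neg_nonneg.2 h0)
          (by rw [neg_add, neg_neg, ← sub_eq_add_neg, sub_le_iff_le_add']; exact h) hd
      simpa using Δ.neg_mem h1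
  le_total p q := by
    obtain ⟨a, rfl⟩ := Δ.ε_surjective p
    obtain ⟨b, rfl⟩ := Δ.ε_surjective q
    exact (le_total a b).imp (fun h => Δ.ε_le_ε h) (fun h => Δ.ε_le_ε h)
  toDecidableLE := Classical.decRel _

instance : IsOrderedAddMonoid Δ.Quo where
  add_le_add_left p q h r := by
    obtain ⟨c, rfl⟩ := Δ.ε_surjective r
    obtain ⟨a, b, rfl, rfl, h⟩ := h
    rw [← map_add, ← map_add]
    exact Δ.ε_le_ε (add_le_add_left h c)

/-- The map `ε`, extended by `ε ∞ = ∞`. -/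
def εTop : WithTop Γ →+ WithTop Δ.Quo := AddMonoidHom.withTopMap Δ.ε

theorem εTop_mono : Monotone Δ.εTop := WithTop.monotone_map_iff.2 fun _ _ h => Δ.ε_le_ε h

/-- The coarser valuation `ε ∘ v`. -/
noncomputable def coarsen {K : Type*} [Field K] (v : AddValuation K (WithTop Γ)) :
    AddValuation K (WithTop Δ.Quo) :=
  v.map Δ.εTop rfl Δ.εTop_mono

theorem coarsen_apply {K : Type*} [Field K] (v : AddValuation K (WithTop Γ)) (a : K) :
    Δ.coarsen v a = Δ.εTop (v a) := rfl

end ConvexSubgroup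

end OrderedGroups

section Valuations

variable {Γ : Type*} [AddCommGroup Γ] [LinearOrder Γ] [IsOrderedAddMonoid Γ]

/-- The value group `Γ_F = v(Fˣ)`. -/
def valueGroup {F : Type*} [Field F] (v : AddValuation F (WithTop Γ)) : AddSubgroup Γ where
  carrier := {γ | ∃ a : F, v a = γ}
  zero_mem' := ⟨1, v.map_one⟩
  add_mem' := by
    rintro x y ⟨a, ha⟩ ⟨b, hb⟩
    exact ⟨a * b, by rw [v.map_mul, ha, hb, WithTop.coe_add]⟩
  neg_mem' := by
    rintro x ⟨a, ha⟩
    exact ⟨a⁻¹, by rw [v.map_inv, ha]; rfl⟩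

/-- The valuation ring `{x | 0 ≤ v x}`. -/
def valuationRing {F : Type*} [Field F] (v : AddValuation F (WithTop Γ)) : ValuationSubring F where
  carrier := {x | 0 ≤ v x}
  mul_mem' {a b} ha hb := by
    simp only [Set.mem_ofPred_eq, v.map_mul] at *
    exact add_nonneg ha hb
  one_mem' := by simp
  add_mem' {a b} ha hb := v.map_le_add ha hb
  zero_mem' := by simp
  neg_mem' {a} ha := by simpa using ha
  mem_or_inv_mem' a := by
    by_cases h : a = 0
    · left; simp [h]
    · rcases le_total 0 (v a) with h0 | h0
      · exact Or.inl h0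
      · right
        have h1 : v a + v a⁻¹ = 0 := by rw [← v.map_mul, mul_inv_cancel₀ h, v.map_one]
        change 0 ≤ v a⁻¹
        rw [← h1]
        simpa using add_le_add_left h0 (v a⁻¹)

/-- `(K, vK)` is a Henselization of `(F, v)`: a Henselian valued field extension of `(F, v)` which
has a unique value-preserving embedding over `F` into every Henselian valued field extension of
`(F, v)`. Since only the valuation ring `B` of the target `L` matters here, the universal property
is stated in terms of `B`. The decomposition field of an extension of `v` to the separable closure
of `F` has the universe level of `F`, so it is enough to consider targets `L` of that level. -/
structure IsHenselization {F : Type u} [Field F] {K : Type*} [Field K] [Algebra F K]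
    (v : AddValuation F (WithTop Γ)) (vK : AddValuation K (WithTop Γ)) : Prop where
  map_eq : ∀ a : F, vK (algebraMap F K a) = v a
  henselian : HenselianLocalRing (valuationRing vK)
  universal : ∀ (L : Type u) [Field L] [Algebra F L] (B : ValuationSubring L),
    HenselianLocalRing B → B.comap (algebraMap F L) = valuationRing v →
      ∃! φ : K →ₐ[F] L, B.comap (φ : K →+* L) = valuationRing vK

end Valuations

section Norms

variable {Γ : Type*} [AddCommGroup Γ] [LinearOrder Γ] [IsOrderedAddMonoid Γ]
variable {F : Type*} [Field F] {V : Type*} [AddCommGroup V] [Module F V]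

/-- A `v`-value function on the `F`-vector space `V`. -/
structure IsValueFunction (v : AddValuation F (WithTop Γ)) (α : V → WithTop Γ) : Prop where
  eq_top_iff : ∀ x, α x = ⊤ ↔ x = 0
  min_le_add : ∀ x y, min (α x) (α y) ≤ α (x + y)
  map_smul : ∀ (c : F) (x : V), α (c • x) = α x + v c

/-- A splitting base of `V` for `α`. -/
def IsSplittingBase {ι : Type*} [Fintype ι] (α : V → WithTop Γ) (e : Module.Basis ι F V) : Prop :=
  ∀ c : ι → F, α (∑ i, c i • e i) = Finset.univ.inf fun i => α (c i • e i)

/-- A `v`-norm on `V`: a value function on a finite-dimensional space that admits a splitting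
base. -/
def IsNorm (v : AddValuation F (WithTop Γ)) (α : V → WithTop Γ) : Prop :=
  IsValueFunction v α ∧ ∃ (n : ℕ) (e : Module.Basis (Fin n) F V), IsSplittingBase α e

variable {K : Type*} [Field K] [Algebra F K]

/-- The restriction to `V` of a function on the scalar extension, where `x` in `V` is identified
with `1 ⊗ x`. -/
def restrict (α : K ⊗[F] V → WithTop Γ) : V → WithTop Γ := fun x => α (1 ⊗ₜ[F] x)

/-- The function `∑ kᵢ ⊗ eᵢ ↦ min (α eᵢ + vK kᵢ)` attached to a base `e` of `V`. -/
noncomputable def tensorFun {ι : Type*} [Fintype ι] (α : V → WithTop Γ)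
    (vK : AddValuation K (WithTop Γ)) (e : Module.Basis ι F V) : K ⊗[F] V → WithTop Γ :=
  fun x => Finset.univ.inf fun i => α (e i) + vK ((Algebra.TensorProduct.basis K e).repr x i)

/-- The value function `α ⊗ vK` on the scalar extension of `V` to `K`, for a `v`-norm `α` on `V`:
take any splitting base `e` of `V` for `α`, and put `(α ⊗ vK)(∑ kᵢ ⊗ eᵢ) = min (α eᵢ + vK kᵢ)`.
See `tensorNorm_eq` for the independence of the choice of `e`. -/
noncomputable def tensorNorm {v : AddValuation F (WithTop Γ)} {α : V → WithTop Γ}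
    (hα : IsNorm v α) (vK : AddValuation K (WithTop Γ)) : K ⊗[F] V → WithTop Γ :=
  tensorFun α vK hα.2.choose_spec.choose

theorem tensorFun_le {ι κ : Type*} [Fintype ι] [Fintype κ] {v : AddValuation F (WithTop Γ)}
    {α : V → WithTop Γ} (hα : IsValueFunction v α) (vK : AddValuation K (WithTop Γ))
    (hK : ∀ a : F, vK (algebraMap F K a) = v a) (e : Module.Basis ι F V)
    (he : IsSplittingBase α e) (f : Module.Basis κ F V) (x : K ⊗[F] V) :
    tensorFun α vK f x ≤ tensorFun α vK e x := by
  classical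
  refine Finset.le_inf fun i _ => ?_
  have hx : (Algebra.TensorProduct.basis K e).repr x i
      = ∑ j, (Algebra.TensorProduct.basis K f).repr x j * algebraMap F K (e.repr (f j) i) := by
    conv_lhs => rw [← (Algebra.TensorProduct.basis K f).sum_repr x]
    simp [Finsupp.finsetSum_apply, mul_comm]
  have hf : ∀ j, α (f j) ≤ α (e i) + v (e.repr (f j) i) := by
    intro j
    have h := he (fun i => e.repr (f j) i)
    rw [e.sum_repr] at h
    rw [h, ← hα.map_smul]
    exact Finset.inf_le (Finset.mem_univ i)
  have key : ∀ (s : Finset κ), tensorFun α vK f x ≤ α (e i) +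
      vK (∑ j ∈ s, (Algebra.TensorProduct.basis K f).repr x j
        * algebraMap F K (e.repr (f j) i)) := by
    intro s
    induction s using Finset.induction_on with
    | empty => simp
    | insert a s ha ih =>
      rw [Finset.sum_insert ha]
      refine le_trans ?_ (add_le_add_right (vK.map_add _ _) _)
      rw [← min_add_add_left]
      refine le_min ?_ ih
      rw [vK.map_mul, hK, add_comm (vK _), ← add_assoc]
      refine le_trans ?_ (add_le_add_left (hf a) _)
      exact Finset.inf_le (f := fun i => α (f i) +
        vK ((Algebra.TensorProduct.basis K f).repr x i)) (Finset.mem_univ a)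
  rw [hx]
  exact key Finset.univ

theorem tensorNorm_eq {ι : Type*} [Fintype ι] {v : AddValuation F (WithTop Γ)}
    {α : V → WithTop Γ} (hα : IsNorm v α) (vK : AddValuation K (WithTop Γ))
    (hK : ∀ a : F, vK (algebraMap F K a) = v a) (e : Module.Basis ι F V)
    (he : IsSplittingBase α e) : tensorNorm hα vK = tensorFun α vK e :=
  funext fun x => le_antisymm (tensorFun_le hα.1 vK hK e he _ x)
    (tensorFun_le hα.1 vK hK _ hα.2.choose_spec.choose_spec e x)

end Norms

end NormDescent

/-! The heart is an approximation theorem (`IsHenselization.exists_lt_map_sub`): an element `k` of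
the Henselization is approximated by elements of `F` with error of value above `vK k + v d`,
whenever `v d ≥ 0` lies below a multiple of every positive value of `v`. No explicit construction of
the Henselization is used. By the universal property it embeds into any Henselian extension, so one
Henselian extension with this property suffices. Extend the valuation ring to the algebraic closure
and take, by Zorn, a maximal approximable intermediate field `E`. It is Henselian: otherwise it
misses the root `r` of some monic `f` near a simple approximate root `a`, and
`IsApproximable.adjoin` shows that `E(r)` is still approximable.

That step is an induction on `deg f`. Let `I` be the ideal of elements of larger value than every `r
- c`, for `c` integral in `E`. Newton iteration makes `I` prime. If `g(r) ∈ I` with `deg g < deg f`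
and `g` primitive, the minimal polynomial `p` of `r` modulo `I` has lower degree than `f`, and `a`
is a simple approximate root of it. By induction `p` has a root `b` in `E`; then `p(r)` and `r - b`
are associates, which contradicts `p(r) ∈ I`. So `f(a)^N * g(r)` lies outside `I`, hence divides
some `r - c`, and so divides `g(r) - g(c)`.

For the descent, approximate the coordinates of a splitting base of `V ⊗ Fh` in a base of `V`. A
family in `V` close enough to a splitting base is again one (`exists_isNorm_restrict_of_approx`).
The two sets of hypotheses serve to keep the required precision within reach of the approximation
theorem. -/

namespace NormDescent

/-! ### Newton approximation and the ideal of elements closer than any approximation -/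

section HenselApproximation

open Polynomial

/-- Version of `exists_monic_map_dvd` for a surjection onto a subring of `S`. -/
theorem exists_monic_map_dvd_of_surjective {O A S : Type*} [CommRing O] [IsDomain O]
    [ValuationRing O] [CommRing A] [IsDomain A] [CommRing S] [IsDomain S] [Algebra A S]
    [FaithfulSMul A S] (ψ : O →+* A) (hψ : Function.Surjective ψ) (r : S) (f : O[X])
    (hf : f.Monic) (hr : aeval r (f.map ψ) = 0) :
    ∃ p : O[X], p.Monic ∧ aeval r (p.map ψ) = 0 ∧
      ∀ g : O[X], aeval r (g.map ψ) = 0 → ∃ q : O[X], g.map ψ = p.map ψ * q.map ψ := by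
  -- A domain that is a quotient of a valuation ring is a valuation ring, hence integrally closed,
  -- so minimal polynomials over it divide every annihilating polynomial.
  have hv : ValuationRing A := Function.Surjective.valuationRing ψ hψ
  have hint : IsIntegral A r := ⟨f.map ψ, hf.map _, hr⟩
  have hlift : ∀ q : A[X], ∃ q' : O[X], q'.map ψ = q := map_surjective _ hψ
  obtain ⟨p, hp, -, hpm⟩ := lifts_and_natDegree_eq_and_monic
    ((mem_lifts _).2 (hlift (minpoly A r))) (minpoly.monic hint)
  refine ⟨p, hpm, by rw [hp, minpoly.aeval], fun g hg => ?_⟩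
  obtain ⟨q, hq⟩ := minpoly.isIntegrallyClosed_dvd hint hg
  obtain ⟨q', rfl⟩ := hlift q
  exact ⟨q', by rw [hq, hp]⟩

/-- Over a valuation ring mapping to a domain, an integral element has a monic polynomial whose
image divides the image of every polynomial that vanishes at the element. -/
theorem exists_monic_map_dvd {O S : Type*} [CommRing O] [IsDomain O] [ValuationRing O] [CommRing S]
    [IsDomain S] (φ : O →+* S) (r : S) (f : O[X]) (hf : f.Monic) (hr : f.eval₂ φ r = 0) :
    ∃ p : O[X], p.Monic ∧ p.eval₂ φ r = 0 ∧
      ∀ g : O[X], g.eval₂ φ r = 0 → ∃ q : O[X], g.map φ = p.map φ * q.map φ := by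
  have hcomp : (algebraMap φ.range S).comp φ.rangeRestrict = φ := by ext; rfl
  have haev : ∀ g : O[X], aeval r (g.map φ.rangeRestrict) = g.eval₂ φ r := by
    intro g
    rw [aeval_def, eval₂_map, hcomp]
  have hfaith : FaithfulSMul φ.range S :=
    (faithfulSMul_iff_algebraMap_injective _ _).2 Subtype.val_injective
  obtain ⟨p, hpm, hp, h⟩ := exists_monic_map_dvd_of_surjective φ.rangeRestrict
    φ.rangeRestrict_surjective r f hf (by rw [haev, hr])
  refine ⟨p, hpm, by rw [← haev, hp], fun g hg => ?_⟩
  obtain ⟨q, hq⟩ := h g (by rw [haev, hg])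
  refine ⟨q, ?_⟩
  rw [← Polynomial.map_mul] at hq
  have := congrArg (Polynomial.map (algebraMap φ.range S)) hq
  rwa [Polynomial.map_map, Polynomial.map_map, hcomp, Polynomial.map_mul] at this

/-- One step of Newton approximation to a root. -/
theorem exists_sq_dvd_sub {O B : Type*} [CommRing O] [CommRing B] (φ : O →+* B) (f : O[X]) (r : B)
    (hr : f.eval₂ φ r = 0) (c : O) (hc : IsUnit (f.derivative.eval c)) :
    ∃ c' : O, (r - φ c) ^ 2 ∣ r - φ c' := by
  obtain ⟨u, hu⟩ := hc.exists_right_inv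
  obtain ⟨k, hk⟩ := (f.map φ).binomExpansion (φ c) (r - φ c)
  rw [add_sub_cancel, eval_map, hr, derivative_map, eval_map, eval_map, eval₂_at_apply,
    eval₂_at_apply] at hk
  have hu' : φ (f.derivative.eval c) * φ u = 1 := by rw [← map_mul, hu, map_one]
  -- The Newton iterate `c - f(c) / f'(c)`.
  refine ⟨c - f.eval c * u, -(k * φ u), ?_⟩
  rw [map_sub, map_mul]
  linear_combination (-φ u) * hk - (r - φ c) * hu'

variable {O B : Type*} [CommRing O] [IsDomain O] [ValuationRing O]
  [CommRing B] [IsDomain B] [ValuationRing B]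

/-- The elements which are smaller than the distance from `r` to all elements of the image of `φ`. -/
def closeIdeal (φ : O →+* B) (r : B) (hr : ∀ c, φ c ≠ r) : Ideal B where
  carrier := {z | ∀ c, ¬ z ∣ r - φ c}
  zero_mem' c h := hr c (sub_eq_zero.1 (zero_dvd_iff.1 h)).symm
  add_mem' {z w} hz hw c h := by
    rcases ValuationRing.dvd_total z w with hzw | hzw
    · exact hz c ((dvd_add dvd_rfl hzw).trans h)
    · exact hw c ((dvd_add hzw dvd_rfl).trans h)
  smul_mem' b z hz c h := hz c ((dvd_mul_left z b).trans h)

/-- If `r` is a simple root of `f`, then `closeIdeal φ r` is prime. -/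
theorem closeIdeal_isPrime (φ : O →+* B) [IsLocalHom φ] (f : O[X]) (a : O)
    (ha : IsUnit (f.derivative.eval a)) (r : B) (hf : f.eval₂ φ r = 0)
    (hra : r - φ a ∈ IsLocalRing.maximalIdeal B) (hr : ∀ c, φ c ≠ r) :
    (closeIdeal φ r hr).IsPrime := by
  refine ⟨fun h => ?_, fun {z w} hzw => ?_⟩
  · have h1 : (1 : B) ∈ closeIdeal φ r hr := h ▸ Submodule.mem_top
    exact h1 0 (one_dvd _)
  by_contra! hcon
  obtain ⟨hz, hw⟩ := hcon
  have hz' : ∃ c, z ∣ r - φ c := by simpa [closeIdeal] using hz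
  have hw' : ∃ c, w ∣ r - φ c := by simpa [closeIdeal] using hw
  have key : ∃ c, z ∣ r - φ c ∧ w ∣ r - φ c := by
    obtain ⟨c, hc⟩ := hz'
    obtain ⟨d, hd⟩ := hw'
    rcases ValuationRing.dvd_total (r - φ c) (r - φ d) with h | h
    · exact ⟨d, hc.trans h, hd⟩
    · exact ⟨c, hc, hd.trans h⟩
  obtain ⟨c, hzc, hwc⟩ := key
  by_cases hu : IsUnit (r - φ c)
  · exact hzw 0 (((isUnit_of_dvd_unit hzc hu).mul (isUnit_of_dvd_unit hwc hu)).dvd)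
  -- Here `c` lies in the residue class of `a`, so `f'(c)` is a unit and a Newton step from `c`
  -- squares the error.
  · have hca : c - a ∈ IsLocalRing.maximalIdeal O := by
      refine (IsLocalRing.mem_maximalIdeal _).2 fun h => ?_
      have h1 : φ (c - a) ∈ IsLocalRing.maximalIdeal B := by
        have h2 : φ (c - a) = (r - φ a) - (r - φ c) := by rw [map_sub]; ring
        rw [h2]
        exact Ideal.sub_mem _ hra ((IsLocalRing.mem_maximalIdeal _).2 hu)
      exact (IsLocalRing.mem_maximalIdeal _).1 h1 (h.map φ)
    have hc : IsUnit (f.derivative.eval c) := by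
      by_contra hcu
      have h1 : f.derivative.eval c - f.derivative.eval a ∈ IsLocalRing.maximalIdeal O :=
        Ideal.mem_of_dvd _ (sub_dvd_eval_sub c a _) hca
      have h2 := Ideal.sub_mem _ ((IsLocalRing.mem_maximalIdeal _).2 hcu) h1
      rw [sub_sub_cancel] at h2
      exact (IsLocalRing.mem_maximalIdeal _).1 h2 ha
    obtain ⟨c', hc'⟩ := exists_sq_dvd_sub φ f r hf c hc
    exact hzw c' ((sq (r - φ c) ▸ mul_dvd_mul hzc hwc).trans hc')

/-- Let `f` be a monic polynomial with a simple root `r` in the residue class of `a`, such that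
`r` is not in `O`, and that simple approximate roots of polynomials of lower degree lift to `O`.
Then every polynomial of lower degree, not vanishing modulo the maximal ideal, is nonzero at `r`
modulo `closeIdeal φ r`. -/
theorem eval₂_notMem_closeIdeal (φ : O →+* B) [IsLocalHom φ] (f : O[X]) (hfm : f.Monic) (a : O)
    (ha : IsUnit (f.derivative.eval a)) (r : B) (hf : f.eval₂ φ r = 0)
    (hra : r - φ a ∈ IsLocalRing.maximalIdeal B) (hr : ∀ c, φ c ≠ r)
    (ih : ∀ p : O[X], p.natDegree < f.natDegree → p.Monic →
      p.eval a ∈ IsLocalRing.maximalIdeal O → IsUnit (p.derivative.eval a) →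
      ∃ b, p.IsRoot b ∧ b - a ∈ IsLocalRing.maximalIdeal O)
    (g : O[X]) (hg : g.degree < f.degree) (i : ℕ) (hi : IsUnit (g.coeff i)) :
    g.eval₂ φ r ∉ closeIdeal φ r hr := by
  intro hgI
  have hprime := closeIdeal_isPrime φ f a ha r hf hra hr
  set I := closeIdeal φ r hr
  let ψ : O →+* B ⧸ I := (Ideal.Quotient.mk I).comp φ
  have hev : ∀ q : O[X], q.eval₂ ψ (Ideal.Quotient.mk I r) = Ideal.Quotient.mk I (q.eval₂ φ r) :=
    fun q => (Polynomial.hom_eval₂ q φ (Ideal.Quotient.mk I) r).symm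
  have hIm : I ≤ IsLocalRing.maximalIdeal B := IsLocalRing.le_maximalIdeal hprime.ne_top
  have hmem : ∀ x : O, φ x ∈ IsLocalRing.maximalIdeal B → x ∈ IsLocalRing.maximalIdeal O :=
    fun x hx => (IsLocalRing.mem_maximalIdeal _).2 fun h =>
      (IsLocalRing.mem_maximalIdeal _).1 hx (h.map φ)
  have hcong : ∀ (q : O[X]), q.eval₂ φ r - φ (q.eval a) ∈ IsLocalRing.maximalIdeal B := by
    intro q
    rw [← eval₂_at_apply, ← eval_map, ← eval_map]
    exact Ideal.mem_of_dvd _ (sub_dvd_eval_sub r (φ a) _) hra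
  obtain ⟨p, hpm, hpr, hp⟩ := exists_monic_map_dvd ψ (Ideal.Quotient.mk I r) f hfm
    (by rw [hev, hf, map_zero])
  have hpI : p.eval₂ φ r ∈ I := by rw [← Ideal.Quotient.eq_zero_iff_mem, ← hev, hpr]
  -- `p` has smaller degree than `f`, since it divides `g`
  have hdeg : p.natDegree < f.natDegree := by
    obtain ⟨q, hq⟩ := hp g (by rw [hev, Ideal.Quotient.eq_zero_iff_mem]; exact hgI)
    -- The unit coefficient survives modulo the proper ideal `I`, so divisibility by `p` bounds the
    -- degree of `p`.
    have hg0 : g.map ψ ≠ 0 := by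
      intro h0
      have := congrArg (fun s => s.coeff i) h0
      simp only [coeff_map, coeff_zero] at this
      exact (hi.map ψ).ne_zero this
    have h1 : (p.map ψ).degree ≤ (g.map ψ).degree := degree_le_of_dvd ⟨_, hq⟩ hg0
    rw [hpm.degree_map] at h1
    have h2 := (h1.trans degree_map_le).trans_lt hg
    exact natDegree_lt_natDegree hpm.ne_zero h2
  have hpa : p.eval a ∈ IsLocalRing.maximalIdeal O := by
    refine hmem _ ?_
    have := Ideal.sub_mem _ (hIm hpI) (hcong p)
    rwa [sub_sub_cancel] at this
  -- Modulo `I`, `f = p * q` gives `f'(r) = p'(r) * q(r)`; as `f'(r)` is a unit, so is `p'(r)`,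
  -- hence `p'(a)`.
  have hpa' : IsUnit (p.derivative.eval a) := by
    obtain ⟨q, hq⟩ := hp f (by rw [hev, hf, map_zero])
    have hd := congrArg (fun s => s.derivative.eval (Ideal.Quotient.mk I r)) hq
    simp only [derivative_mul, eval_add, eval_mul, derivative_map, eval_map] at hd
    rw [hpr, zero_mul, add_zero, hev, hev, hev, ← map_mul, Ideal.Quotient.eq] at hd
    by_contra hnu
    have h1 : p.derivative.eval₂ φ r ∈ IsLocalRing.maximalIdeal B := by
      have h2 : φ (p.derivative.eval a) ∈ IsLocalRing.maximalIdeal B :=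
        (IsLocalRing.mem_maximalIdeal _).2 fun h => hnu (isUnit_of_map_unit φ _ h)
      have := Ideal.add_mem _ (hcong p.derivative) h2
      rwa [sub_add_cancel] at this
    have h3 := Ideal.add_mem _ (hIm hd) (Ideal.mul_mem_right (q.eval₂ φ r) _ h1)
    rw [sub_add_cancel] at h3
    have h4 := Ideal.sub_mem _ h3 (hcong f.derivative)
    rw [sub_sub_cancel] at h4
    exact (IsLocalRing.mem_maximalIdeal _).1 (hmem _ h4) ha
  obtain ⟨b, hb, hba⟩ := ih p hdeg hpm hpa hpa'
  -- `p r` and `r - b` are associated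
  obtain ⟨k, hk⟩ := (p.map φ).binomExpansion (φ b) (r - φ b)
  rw [add_sub_cancel, eval_map, derivative_map, eval_map, eval_map, eval₂_at_apply,
    eval₂_at_apply, hb.eq_zero, map_zero, zero_add, sq, ← mul_assoc, ← add_mul] at hk
  have hbB : φ (b - a) ∈ IsLocalRing.maximalIdeal B :=
    (IsLocalRing.mem_maximalIdeal _).2 fun h =>
      (IsLocalRing.mem_maximalIdeal _).1 hba (isUnit_of_map_unit φ _ h)
  have hrb : r - φ b ∈ IsLocalRing.maximalIdeal B := by
    have := Ideal.sub_mem _ hra hbB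
    rwa [map_sub, sub_sub_sub_cancel_right] at this
  have hunit : IsUnit (φ (p.derivative.eval b) + k * (r - φ b)) := by
    by_contra hnu
    have h1 := Ideal.sub_mem _ ((IsLocalRing.mem_maximalIdeal _).2 hnu)
      (Ideal.mul_mem_left _ k hrb)
    rw [add_sub_cancel_right] at h1
    have h2 : p.derivative.eval b - p.derivative.eval a ∈ IsLocalRing.maximalIdeal O :=
      Ideal.mem_of_dvd _ (sub_dvd_eval_sub b a _) hba
    have h3 := Ideal.sub_mem _ (hmem _ h1) h2
    rw [sub_sub_cancel] at h3
    exact (IsLocalRing.mem_maximalIdeal _).1 h3 hpa'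
  refine hpI b ?_
  rw [hk]
  exact (hunit.mul_left_dvd).2 dvd_rfl

/-- In the situation of `eval₂_notMem_closeIdeal`, the value of `g` at `r` is approximated by its
values at elements of `O`. -/
theorem exists_pow_mul_eval₂_dvd (φ : O →+* B) [IsLocalHom φ] (f : O[X]) (hfm : f.Monic) (a : O)
    (ha : IsUnit (f.derivative.eval a)) (r : B) (hf : f.eval₂ φ r = 0)
    (hra : r - φ a ∈ IsLocalRing.maximalIdeal B) (hr : ∀ c, φ c ≠ r)
    (ih : ∀ p : O[X], p.natDegree < f.natDegree → p.Monic →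
      p.eval a ∈ IsLocalRing.maximalIdeal O → IsUnit (p.derivative.eval a) →
      ∃ b, p.IsRoot b ∧ b - a ∈ IsLocalRing.maximalIdeal O)
    (g : O[X]) (hg : g.degree < f.degree) (i : ℕ) (hi : IsUnit (g.coeff i)) (N : ℕ) :
    ∃ c, φ (f.eval a) ^ N * g.eval₂ φ r ∣ g.eval₂ φ r - φ (g.eval c) := by
  have hprime := closeIdeal_isPrime φ f a ha r hf hra hr
  have h1 := eval₂_notMem_closeIdeal φ f hfm a ha r hf hra hr ih g hg i hi
  -- By Taylor expansion at `a`, `f(a)` is a unit times `r - a`.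
  have h2 : φ (f.eval a) ∉ closeIdeal φ r hr := by
    intro h
    refine h a ?_
    obtain ⟨k, hk⟩ := (f.map φ).binomExpansion (φ a) (r - φ a)
    rw [add_sub_cancel, eval_map, derivative_map, eval_map, eval_map, eval₂_at_apply,
      eval₂_at_apply, hf, sq, ← mul_assoc, add_assoc, ← add_mul] at hk
    have hunit : IsUnit (φ (f.derivative.eval a) + k * (r - φ a)) := by
      by_contra hnu
      have h1 := Ideal.sub_mem _ ((IsLocalRing.mem_maximalIdeal _).2 hnu)
        (Ideal.mul_mem_left _ k hra)
      rw [add_sub_cancel_right] at h1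
      exact (IsLocalRing.mem_maximalIdeal _).1 h1 (ha.map φ)
    refine (hunit.dvd_mul_left).1 ?_
    rw [eq_neg_of_add_eq_zero_left hk.symm, neg_dvd]
  have h3 : φ (f.eval a) ^ N * g.eval₂ φ r ∉ closeIdeal φ r hr := fun h =>
    (hprime.mem_or_mem h).elim (fun h => h2 (hprime.mem_of_pow_mem _ h)) h1
  have h4 : ∃ c, φ (f.eval a) ^ N * g.eval₂ φ r ∣ r - φ c := by simpa [closeIdeal] using h3
  obtain ⟨c, hc⟩ := h4
  refine ⟨c, hc.trans ?_⟩
  rw [← eval₂_at_apply, ← eval_map, ← eval_map]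
  exact sub_dvd_eval_sub _ _ _

end HenselApproximation

/-! ### Approximable subextensions of an algebraically closed field -/

section HenselianSubextension

open Polynomial

/-- Every monic polynomial over a valuation ring of an algebraically closed field has a root in the
residue class of any approximate root. -/
theorem exists_root_sub_mem {Ω : Type*} [Field Ω] [IsAlgClosed Ω] (B : ValuationSubring Ω)
    (f : B[X]) (hf : f.Monic) (a : B) (ha : f.eval a ∈ IsLocalRing.maximalIdeal B) :
    ∃ r : B, f.eval r = 0 ∧ r - a ∈ IsLocalRing.maximalIdeal B := by
  have hs := IsAlgClosed.splits (f.map B.subtype)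
  have hprod := hs.eq_prod_roots_of_monic (hf.map _)
  have hev : B.subtype (f.eval a) = (((f.map B.subtype).roots).map fun r => (a : Ω) - r).prod := by
    rw [← eval₂_at_apply, ← eval_map]
    conv_lhs => rw [hprod]
    rw [eval_multiset_prod, Multiset.map_map]
    simp
  have hlt : B.valuation (B.subtype (f.eval a)) < 1 := (B.valuation_lt_one_iff _).1 ha
  -- `f(a)` is the product of the `a - r` over the roots, so not all factors can have valuation at
  -- least `1`.
  have : ∃ r ∈ (f.map B.subtype).roots, B.valuation ((a : Ω) - r) < 1 := by
    by_contra! hcon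
    rw [hev, map_multiset_prod, Multiset.map_map] at hlt
    refine absurd hlt (not_lt.2 ?_)
    refine Multiset.one_le_prod_of_one_le ?_
    intro x hx
    obtain ⟨r, hr, rfl⟩ := Multiset.mem_map.1 hx
    exact hcon r hr
  obtain ⟨r, hr, hra⟩ := this
  have hsub : (a : Ω) - r ∈ B := (B.valuation_le_one_iff _).1 hra.le
  have hrB : r ∈ B := by simpa using B.toSubring.sub_mem a.2 hsub
  refine ⟨⟨r, hrB⟩, ?_, ?_⟩
  · have := isRoot_of_mem_roots hr
    rw [IsRoot, eval_map] at this
    apply Subtype.val_injective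
    change B.subtype (f.eval ⟨r, hrB⟩) = 0
    rw [← eval₂_at_apply]
    exact this
  · rw [← neg_mem_iff, neg_sub]
    exact (B.valuation_lt_one_iff _).2 hra

variable {F Ω : Type*} [Field F] [Field Ω] [Algebra F Ω] (B : ValuationSubring Ω)

/-- The nonzero integral elements of `F` that divide a power of every non-unit. -/
def powerBounds : Set F :=
  {d | d ≠ 0 ∧ B.valuation (algebraMap F Ω d) ≤ 1 ∧ ∀ a : F, B.valuation (algebraMap F Ω a) < 1 →
    ∃ N : ℕ, B.valuation (algebraMap F Ω a) ^ N < B.valuation (algebraMap F Ω d)}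

/-- With `d = 1`, approximability says that every nonzero element of `E` has the value of some
element of `F`. -/
theorem one_mem_powerBounds : (1 : F) ∈ powerBounds B :=
  ⟨one_ne_zero, by simp, fun a ha => ⟨1, by simpa using ha⟩⟩

/-- Every element of `E` is approximated by elements of `F`, with a relative error smaller than
any element of `powerBounds B`. -/
def IsApproximable (E : IntermediateField F Ω) : Prop :=
  ∀ k ∈ E, k ≠ 0 → ∀ d ∈ powerBounds (F := F) B,
    ∃ c : F, B.valuation (k - algebraMap F Ω c) < B.valuation (k * algebraMap F Ω d)

/-- The inclusion of the valuation ring of a subextension. -/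
def inclusionComap (E : IntermediateField F Ω) : B.comap (algebraMap E Ω) →+* B :=
  (algebraMap E Ω).restrict _ _ fun _ h => h

instance (E : IntermediateField F Ω) : IsLocalHom (inclusionComap B E) where
  map_nonunit x hx := by
    obtain ⟨y, hy⟩ := hx.exists_right_inv
    have hy' : ((x : E) : Ω) * y = 1 := congrArg Subtype.val hy
    have hx0 : ((x : E) : Ω) ≠ 0 := left_ne_zero_of_mul_eq_one hy'
    have hinv : (x : E)⁻¹ ∈ B.comap (algebraMap E Ω) := by
      change algebraMap E Ω (x : E)⁻¹ ∈ B
      rw [map_inv₀]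
      change ((x : E) : Ω)⁻¹ ∈ B
      rw [inv_eq_of_mul_eq_one_right hy']
      exact y.2
    refine IsUnit.of_mul_eq_one ⟨_, hinv⟩ (Subtype.ext ?_)
    exact mul_inv_cancel₀ (fun h => hx0 (by rw [h]; rfl))

/-- A nonzero polynomial over the fraction field of a valuation ring is a multiple of an integral
polynomial having a unit coefficient. -/
theorem exists_eq_C_mul_map {E : Type*} [Field E] (O : ValuationSubring E) (P : E[X]) (hP : P ≠ 0) :
    ∃ (e : E) (g : O[X]) (i : ℕ), e ≠ 0 ∧ IsUnit (g.coeff i) ∧ P = C e * g.map O.subtype := by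
  obtain ⟨i, hi, hmax⟩ := P.support.exists_max_image (fun j => O.valuation (P.coeff j))
    (by simpa using hP)
  have he : P.coeff i ≠ 0 := mem_support_iff.1 hi
  have hlift : ∃ g : O[X], g.map O.subtype = C (P.coeff i)⁻¹ * P := by
    rw [← mem_lifts, lifts_iff_coeff_lifts]
    intro j
    rw [coeff_C_mul]
    refine ⟨⟨(P.coeff i)⁻¹ * P.coeff j, ?_⟩, rfl⟩
    rw [← O.valuation_le_one_iff, map_mul, map_inv₀, inv_mul_le_one₀]
    · by_cases hj : j ∈ P.support
      · exact hmax j hj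
      · rw [notMem_support_iff.1 hj, map_zero]
        exact zero_le
    · exact zero_lt_iff.2 ((Valuation.ne_zero_iff _).2 he)
  obtain ⟨g, hg⟩ := hlift
  refine ⟨P.coeff i, g, i, he, ?_, ?_⟩
  · have h := congrArg (fun q => q.coeff i) hg
    simp only [coeff_map, coeff_C_mul, inv_mul_cancel₀ he] at h
    have : g.coeff i = 1 := Subtype.ext h
    rw [this]
    exact isUnit_one
  · rw [hg, ← mul_assoc, ← C_mul, mul_inv_cancel₀ he, C_1, one_mul]

variable {B}

/-- Every element of `E(r)` is `e * g(r)` with `g` primitive of degree below that of `f`. It is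
first approximated by `e * g(c)` in `E`, then by an element of `F`; both errors meet the same bound
because the first step preserves the value. -/
theorem IsApproximable.adjoin {E : IntermediateField F Ω} (hE : IsApproximable B E)
    (f : (B.comap (algebraMap E Ω))[X]) (hfm : f.Monic) (a : B.comap (algebraMap E Ω))
    (hfa : f.eval a ∈ IsLocalRing.maximalIdeal (B.comap (algebraMap E Ω)))
    (ha : IsUnit (f.derivative.eval a)) (r : B) (hf : f.eval₂ (inclusionComap B E) r = 0)
    (hra : r - inclusionComap B E a ∈ IsLocalRing.maximalIdeal B)
    (hr : ∀ c, inclusionComap B E c ≠ r)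
    (ih : ∀ p : (B.comap (algebraMap E Ω))[X], p.natDegree < f.natDegree → p.Monic →
      p.eval a ∈ IsLocalRing.maximalIdeal (B.comap (algebraMap E Ω)) →
      IsUnit (p.derivative.eval a) →
      ∃ b, p.IsRoot b ∧ b - a ∈ IsLocalRing.maximalIdeal (B.comap (algebraMap E Ω))) :
    IsApproximable B ((IntermediateField.adjoin E {(r : Ω)}).restrictScalars F) := by
  let O := B.comap (algebraMap E Ω)
  let φ : O →+* B := inclusionComap B E
  have hcomp : (algebraMap E Ω).comp O.subtype = B.subtype.comp φ := rfl
  have hevr : ∀ g : O[X], aeval (r : Ω) (g.map O.subtype) = (g.eval₂ φ r : B) := by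
    intro g
    rw [aeval_def, eval₂_map, hcomp]
    exact (hom_eval₂ g φ B.subtype r).symm
  have hfm' : (f.map O.subtype).Monic := hfm.map _
  have hfr : aeval (r : Ω) (f.map O.subtype) = 0 := by rw [hevr, hf]; rfl
  have halg : IsIntegral E (r : Ω) := ⟨f.map O.subtype, hfm', hfr⟩
  intro z hz hz0 d hd
  obtain ⟨P, rfl⟩ : ∃ P : E[X], aeval (r : Ω) P = z := by
    rw [IntermediateField.mem_restrictScalars, ← IntermediateField.mem_toSubalgebra,
      IntermediateField.adjoin_simple_toSubalgebra_of_isAlgebraic halg.isAlgebraic,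
      Algebra.adjoin_singleton_eq_range_aeval] at hz
    exact hz
  have hmod : aeval (r : Ω) P = aeval (r : Ω) (P %ₘ f.map O.subtype) := by
    conv_lhs => rw [← modByMonic_add_div P (f.map O.subtype)]
    rw [map_add, map_mul, hfr, zero_mul, add_zero]
  have hdegP : (P %ₘ f.map O.subtype).degree < f.degree := by
    rw [← hfm.degree_map O.subtype]
    exact degree_modByMonic_lt _ hfm'
  rw [hmod] at hz0 ⊢
  generalize P %ₘ f.map O.subtype = Q at hz0 hdegP ⊢
  obtain ⟨e, g, i, he, hi, rfl⟩ := exists_eq_C_mul_map O Q (by rintro rfl; simp at hz0)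
  rw [map_mul, aeval_C, hevr] at hz0 ⊢
  have hgdeg : g.degree < f.degree := by
    rwa [degree_C_mul he, degree_map_eq_of_injective Subtype.val_injective] at hdegP
  have hg0 : ((g.eval₂ φ r : B) : Ω) ≠ 0 := right_ne_zero_of_mul hz0
  have he0 : algebraMap E Ω e ≠ 0 := left_ne_zero_of_mul hz0
  have hV : ∀ x : Ω, x ≠ 0 → 0 < B.valuation x := fun x hx =>
    zero_lt_iff.2 ((Valuation.ne_zero_iff _).2 hx)
  have hd0 : algebraMap F Ω d ≠ 0 := (_root_.map_ne_zero _).2 hd.1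
  -- a power of `f a` is smaller than `d`
  have hN : ∃ N : ℕ, B.valuation (φ (f.eval a) : Ω) ^ N < B.valuation (algebraMap F Ω d) := by
    have hlt : B.valuation (φ (f.eval a) : Ω) < 1 := by
      refine (B.valuation_lt_one_iff _).1 ?_
      exact (IsLocalRing.mem_maximalIdeal _).2 fun h =>
        (IsLocalRing.mem_maximalIdeal _).1 hfa (isUnit_of_map_unit φ _ h)
    by_cases h0 : (φ (f.eval a) : Ω) = 0
    · exact ⟨1, by rw [h0, map_zero, pow_one]; exact hV _ hd0⟩
    -- `powerBounds` only controls elements of `F`, so `f(a)` is replaced by some `b` in `F` of the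
    -- same value.
    · obtain ⟨b, hb⟩ := hE _ (f.eval a).1.2 h0 1 (one_mem_powerBounds B)
      rw [map_one, mul_one] at hb
      have hb' := Valuation.map_eq_of_sub_lt _ ((Valuation.map_sub_swap _ _ _).trans_lt hb)
      change _ = B.valuation (φ (f.eval a) : Ω) at hb'
      rw [← hb'] at hlt ⊢
      exact hd.2.2 b hlt
  obtain ⟨N, hN⟩ := hN
  obtain ⟨c, k, hk⟩ := exists_pow_mul_eval₂_dvd φ f hfm a ha r hf hra hr ih g hgdeg i hi N
  have hk' : ((g.eval₂ φ r : B) : Ω) - ((g.eval c : O) : E) =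
      ((φ (f.eval a) : Ω) ^ N * (g.eval₂ φ r : B)) * k := congrArg Subtype.val hk
  have h1 : B.valuation (((g.eval₂ φ r : B) : Ω) - ((g.eval c : O) : E)) <
      B.valuation (((g.eval₂ φ r : B) : Ω) * algebraMap F Ω d) := by
    rw [hk', map_mul, map_mul, map_mul, map_pow, mul_comm (B.valuation _ ^ N)]
    refine (mul_le_of_le_one_right' (B.valuation_le_one k)).trans_lt ?_
    exact mul_lt_mul_of_pos_left hN (hV _ hg0)
  have h2 : B.valuation (algebraMap E Ω e * (g.eval₂ φ r : B) -
      ((e * (g.eval c : O) : E) : Ω)) <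
      B.valuation (algebraMap E Ω e * (g.eval₂ φ r : B) * algebraMap F Ω d) := by
    have : algebraMap E Ω e * (g.eval₂ φ r : B) - ((e * (g.eval c : O) : E) : Ω) =
      algebraMap E Ω e * (((g.eval₂ φ r : B) : Ω) - ((g.eval c : O) : E)) := by
      rw [mul_sub]; rfl
    rw [this, mul_assoc, map_mul, map_mul (B.valuation) _ (_ * _)]
    exact mul_lt_mul_of_pos_left h1 (hV _ he0)
  generalize algebraMap E Ω e * (g.eval₂ φ r : B) = z at h2 hz0 ⊢
  generalize e * (g.eval c : O) = y at h2
  have hle : B.valuation (z * algebraMap F Ω d) ≤ B.valuation z := by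
    rw [map_mul]
    exact mul_le_of_le_one_right' hd.2.1
  have hzy : B.valuation (y : Ω) = B.valuation z :=
    Valuation.map_eq_of_sub_lt _ ((Valuation.map_sub_swap _ _ _).trans_lt (h2.trans_le hle))
  have hy0 : (y : Ω) ≠ 0 := by
    rw [← Valuation.ne_zero_iff B.valuation, hzy]
    exact (Valuation.ne_zero_iff _).2 hz0
  obtain ⟨c', hc'⟩ := hE y y.2 hy0 d hd
  refine ⟨c', ?_⟩
  have h3 : z - algebraMap F Ω c' = (z - y) + (y - algebraMap F Ω c') := by ring
  rw [h3]
  refine Valuation.map_add_lt _ h2 ?_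
  rwa [map_mul, ← hzy, ← map_mul]

end HenselianSubextension
-- Approximation of a Henselization by its base field
section HenselizationDensity

open Polynomial

/-- The valuation of an algebraically closed extension of `F` restricts to a Henselian valuation on
some subextension whose elements are approximable by elements of `F`. -/
theorem exists_henselian_isApproximable {F Ω : Type*} [Field F] [Field Ω] [Algebra F Ω]
    [IsAlgClosed Ω] (B : ValuationSubring Ω) :
    ∃ E : IntermediateField F Ω, IsApproximable B E ∧
      HenselianLocalRing (B.comap (algebraMap E Ω)) := by
  obtain ⟨E, -, hE⟩ := zorn_le_nonempty₀ {E : IntermediateField F Ω | IsApproximable B E}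
    (fun c hc hchain E₀ hE₀ => by
      have : Nonempty c := ⟨⟨E₀, hE₀⟩⟩
      refine ⟨⨆ E : c, (E : IntermediateField F Ω), fun k hk => ?_, fun E hE =>
        le_iSup_of_le ⟨E, hE⟩ le_rfl⟩
      rw [← SetLike.mem_coe,
        IntermediateField.coe_iSup_of_directed hchain.directed, Set.mem_iUnion] at hk
      obtain ⟨E, hkE⟩ := hk
      exact hc E.2 k hkE)
    ⊥ (fun k hk hk0 d hd => by
      obtain ⟨c, rfl⟩ := IntermediateField.mem_bot.1 hk
      refine ⟨c, ?_⟩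
      rw [sub_self, map_zero]
      exact zero_lt_iff.2 ((Valuation.ne_zero_iff _).2 (mul_ne_zero hk0 ((_root_.map_ne_zero _).2 hd.1))))
  refine ⟨E, hE.prop, { is_henselian := fun f hfm a hfa ha => ?_ }⟩
  induction hn : f.natDegree using Nat.strong_induction_on generalizing f with
  | _ n ih =>
    obtain ⟨r, hr, hra⟩ := exists_root_sub_mem B (f.map (inclusionComap B E)) (hfm.map _)
      (inclusionComap B E a) (by
        rw [eval_map, eval₂_at_apply]
        exact (IsLocalRing.mem_maximalIdeal _).2 fun h =>
          (IsLocalRing.mem_maximalIdeal _).1 hfa (isUnit_of_map_unit _ _ h))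
    rw [eval_map] at hr
    have hinj : Function.Injective (inclusionComap B E) := fun x y h =>
      Subtype.ext (Subtype.ext (congrArg (Subtype.val : B → Ω) h))
    have hc : ∃ c, inclusionComap B E c = r := by
      by_contra! hcon
      have hadj := hE.prop.adjoin f hfm a hfa ha r hr hra hcon
        fun p hp hpm hpa hpa' => ih _ (hn ▸ hp) p hpm hpa hpa' rfl
      have hle : E ≤ (IntermediateField.adjoin E {(r : Ω)}).restrictScalars F := fun x hx =>
        IntermediateField.algebraMap_mem _ (⟨x, hx⟩ : E)
      have hrE : (r : Ω) ∈ E := hE.le_of_ge hadj hle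
        (IntermediateField.mem_adjoin_simple_self E (r : Ω))
      exact hcon ⟨⟨r, hrE⟩, r.2⟩ rfl
    obtain ⟨c, rfl⟩ := hc
    refine ⟨c, hinj ?_, ?_⟩
    · rw [← eval₂_at_apply, hr, map_zero]
    · refine (IsLocalRing.mem_maximalIdeal _).2 fun h => ?_
      rw [← map_sub] at hra
      exact (IsLocalRing.mem_maximalIdeal _).1 hra (h.map _)

/-- A valuation ring of a field extends to any field extension. -/
theorem exists_comap_eq {F Ω : Type*} [Field F] [Field Ω] [Algebra F Ω] (A : ValuationSubring F) :
    ∃ B : ValuationSubring Ω, B.comap (algebraMap F Ω) = A := by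
  obtain ⟨B, hB, hloc⟩ :=
    IsLocalRing.exists_factor_valuationRing ((algebraMap F Ω).comp A.subtype)
  refine ⟨B, le_antisymm (fun x hx => ?_) fun x hx => hB ⟨x, hx⟩⟩
  rcases A.mem_or_inv_mem x with h | h
  · exact h
  · by_cases hx0 : x = 0
    · rw [hx0]; exact A.zero_mem
    have hu : IsUnit (⟨x⁻¹, h⟩ : A) := by
      refine hloc.map_nonunit _ (IsUnit.of_mul_eq_one ⟨algebraMap F Ω x, hx⟩ (Subtype.ext ?_))
      change algebraMap F Ω x⁻¹ * algebraMap F Ω x = 1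
      rw [← map_mul, inv_mul_cancel₀ hx0, map_one]
    obtain ⟨y, hy⟩ := hu.exists_right_inv
    have hy' : x⁻¹ * y = 1 := congrArg Subtype.val hy
    have : (y : F) = x := by rw [← inv_eq_of_mul_eq_one_right hy', inv_inv]
    exact this ▸ y.2

variable {Γ : Type*} [AddCommGroup Γ] [LinearOrder Γ] [IsOrderedAddMonoid Γ]

theorem mem_valuationRing {F : Type*} [Field F] (v : AddValuation F (WithTop Γ)) (x : F) :
    x ∈ valuationRing v ↔ 0 ≤ v x := Iff.rfl

theorem add_map_inv {F : Type*} [Field F] (v : AddValuation F (WithTop Γ)) {x : F} (hx : x ≠ 0) :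
    v x + v x⁻¹ = 0 := by
  rw [← v.map_mul, mul_inv_cancel₀ hx, v.map_one]

/-- Comparison of values in terms of the valuation ring. -/
theorem map_le_map_iff_div_mem {F : Type*} [Field F] (v : AddValuation F (WithTop Γ)) {x y : F}
    (hx : x ≠ 0) : v x ≤ v y ↔ y / x ∈ valuationRing v := by
  rw [mem_valuationRing]
  constructor
  · intro h
    have := add_le_add_left h (v x⁻¹)
    rwa [add_map_inv v hx, ← v.map_mul, ← div_eq_mul_inv] at this
  · intro h
    have := add_le_add_left h (v x)
    rwa [zero_add, ← v.map_mul, div_mul_cancel₀ _ hx] at this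

/-- Both orders are divisibility with respect to the valuation ring; passing from additive to
multiplicative notation reverses the inequality. -/
theorem map_lt_map_iff_valuation_lt {F L : Type*} [Field F] [Field L] (φ : F →+* L)
    (v : AddValuation F (WithTop Γ)) (B : ValuationSubring L) (h : B.comap φ = valuationRing v)
    {x y : F} : v x < v y ↔ B.valuation (φ y) < B.valuation (φ x) := by
  by_cases hy : y = 0
  · subst hy
    rw [v.map_zero, map_zero, map_zero, lt_top_iff_ne_top, zero_lt_iff, Ne, Ne, v.top_iff,
      Valuation.zero_iff, map_eq_zero]
  · rw [← not_le, map_le_map_iff_div_mem v hy, ← h, ValuationSubring.mem_comap, map_div₀,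
      ← B.valuation_le_one_iff, map_div₀, div_le_one₀, not_le]
    exact zero_lt_iff.2 ((Valuation.ne_zero_iff _).2 ((_root_.map_ne_zero _).2 hy))

/-- The elements of a Henselization are approximated by elements of the base field, with any
relative error bounding the multiples of all positive values. -/
theorem IsHenselization.exists_lt_map_sub {F : Type u} [Field F] {K : Type*} [Field K] [Algebra F K]
    {v : AddValuation F (WithTop Γ)} {vK : AddValuation K (WithTop Γ)} (h : IsHenselization v vK)
    {k : K} (hk : k ≠ 0) {d : F} (hd : d ≠ 0) (hd0 : 0 ≤ v d)
    (hd' : ∀ a : F, 0 < v a → ∃ N : ℕ, v d < N • v a) :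
    ∃ c : F, vK k + v d < vK (k - algebraMap F K c) := by
  obtain ⟨B, hB⟩ := exists_comap_eq (Ω := AlgebraicClosure F) (valuationRing v)
  obtain ⟨E, hE, hE'⟩ := exists_henselian_isApproximable (F := F) B
  obtain ⟨φ, hφ, -⟩ := h.universal E (B.comap (algebraMap E (AlgebraicClosure F))) hE' hB
  have hlt : ∀ x y : F, v x < v y ↔ B.valuation (algebraMap F _ y) < B.valuation (algebraMap F _ x) :=
    fun x y => map_lt_map_iff_valuation_lt _ v B hB
  have hdB : d ∈ powerBounds B := by
    refine ⟨hd, ?_, fun a ha => ?_⟩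
    · rw [B.valuation_le_one_iff]
      exact hB.ge hd0
    · obtain ⟨N, hN⟩ := hd' a (by
        rw [← v.map_one, hlt, map_one, map_one]; exact ha)
      refine ⟨N, ?_⟩
      rw [← map_pow, ← map_pow, ← hlt, v.map_pow]
      exact hN
  have hφk : ((φ k : E) : AlgebraicClosure F) ≠ 0 := by simpa using hk
  obtain ⟨c, hc⟩ := hE _ (φ k).2 hφk d hdB
  refine ⟨c, ?_⟩
  rw [← h.map_eq, ← vK.map_mul]
  refine (map_lt_map_iff_valuation_lt
    ((algebraMap E (AlgebraicClosure F)).comp (φ : K →+* E)) vK B hφ).2 ?_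
  simpa using hc

end HenselizationDensity
-- Rank one implies archimedean
section RankOne

variable {G : Type*} [AddCommGroup G] [LinearOrder G] [IsOrderedAddMonoid G]

/-- The convex subgroup generated by a positive element. -/
def convexHull (ρ : G) : ConvexSubgroup G where
  carrier := {x | ∃ n : ℕ, |x| ≤ n • ρ}
  zero_mem' := ⟨0, by simp⟩
  add_mem' := by
    rintro a b ⟨m, hm⟩ ⟨n, hn⟩
    exact ⟨m + n, (abs_add_le a b).trans (by rw [add_smul]; exact add_le_add hm hn)⟩
  neg_mem' := by
    rintro a ⟨m, hm⟩
    exact ⟨m, by rwa [abs_neg]⟩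
  convex' := by
    rintro a b ha hab ⟨m, hm⟩
    exact ⟨m, by rw [abs_of_nonneg ha]; exact hab.trans ((le_abs_self b).trans hm)⟩

/-- An ordered group of rank one is archimedean. -/
theorem exists_lt_nsmul_of_rank_eq_one (h : rank G = 1) (x ρ : G) (hρ : 0 < ρ) :
    ∃ n : ℕ, x < n • ρ := by
  obtain ⟨H, hH⟩ := Set.encard_eq_one.1 h
  -- The zero subgroup is the only proper convex subgroup, so the convex hull of `ρ` is everything.
  have hbot : (⟨⊥, by
      rintro a b ha hab hb
      have hb' : b = 0 := hb
      exact le_antisymm (hb' ▸ hab) ha⟩ : ConvexSubgroup G) ∈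
      {H : ConvexSubgroup G | H.toAddSubgroup ≠ ⊤} := by
    intro htop
    have : ρ ∈ (⊥ : AddSubgroup G) := by
      change (⊥ : AddSubgroup G) = ⊤ at htop
      rw [htop]
      trivial
    exact hρ.ne' this
  have hmem : ρ ∈ (convexHull ρ).toAddSubgroup := ⟨1, by rw [abs_of_pos hρ, one_smul]⟩
  have htop : (convexHull ρ).toAddSubgroup = ⊤ := by
    by_contra hne
    have h1 : convexHull ρ ∈ {H : ConvexSubgroup G | H.toAddSubgroup ≠ ⊤} := hne
    rw [hH, Set.mem_singleton_iff] at h1 hbot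
    rw [h1, ← hbot] at hmem
    exact hρ.ne' hmem
  obtain ⟨n, hn⟩ : x ∈ (convexHull ρ).toAddSubgroup := htop ▸ AddSubgroup.mem_top x
  refine ⟨n + 1, ((le_abs_self x).trans hn).trans_lt ?_⟩
  rw [succ_nsmul]
  exact lt_add_of_pos_right _ hρ

end RankOne

/-! ### Perturbing splitting bases and descending norms -/

section Descent

variable {Γ : Type*} [AddCommGroup Γ] [LinearOrder Γ] [IsOrderedAddMonoid Γ]
variable {F : Type*} [Field F] {V : Type*} [AddCommGroup V] [Module F V]

namespace IsValueFunction

variable {v : AddValuation F (WithTop Γ)} {α : V → WithTop Γ}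

theorem map_zero (hα : IsValueFunction v α) : α 0 = ⊤ := (hα.eq_top_iff 0).2 rfl

theorem map_neg (hα : IsValueFunction v α) (x : V) : α (-x) = α x := by
  rw [← neg_one_smul F x, hα.map_smul, v.map_neg, v.map_one, add_zero]

theorem map_sub_lt (hα : IsValueFunction v α) {x y : V} (h : α x < α (x - y)) : α y = α x := by
  apply le_antisymm
  · by_contra! hlt
    have h1 := hα.min_le_add (x - y) y
    rw [sub_add_cancel] at h1
    exact absurd h1 (not_le.2 (lt_min h hlt))
  · have h1 := hα.min_le_add x (-(x - y))
    rw [hα.map_neg, min_eq_left h.le, neg_sub, add_sub_cancel] at h1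
    exact h1

theorem lt_map_sum (hα : IsValueFunction v α) {ι : Type*} (s : Finset ι) (x : ι → V)
    (m : WithTop Γ) (hm : m < ⊤) (h : ∀ i ∈ s, m < α (x i)) : m < α (∑ i ∈ s, x i) := by
  classical
  induction s using Finset.induction_on with
  | empty => simpa [hα.map_zero] using hm
  | insert a s ha ih =>
    rw [Finset.sum_insert ha]
    exact (lt_min (h _ (Finset.mem_insert_self _ _))
      (ih fun i hi => h i (Finset.mem_insert_of_mem hi))).trans_le (hα.min_le_add _ _)

/-- A family close to a splitting base splits the value function. -/
theorem map_sum_smul_of_lt (hα : IsValueFunction v α) {ι : Type*} [Fintype ι]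
    (e : Module.Basis ι F V) (he : IsSplittingBase α e) (e' : ι → V)
    (h : ∀ i, α (e i) < α (e i - e' i)) (c : ι → F) :
    α (∑ i, c i • e' i) = Finset.univ.inf fun i => α (c i • e' i) := by
  have heq : (fun i => α (c i • e' i)) = fun i => α (c i • e i) := by
    funext i
    rw [hα.map_smul, hα.map_smul, hα.map_sub_lt (h i)]
  rw [heq, ← he c]
  by_cases htop : α (∑ i, c i • e i) = ⊤
  · have h0 := (hα.eq_top_iff _).1 htop
    have hc : ∀ i, c i = 0 := Fintype.linearIndependent_iff.1 e.linearIndependent c h0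
    simp [hc]
  · apply hα.map_sub_lt
    rw [← Finset.sum_sub_distrib]
    refine hα.lt_map_sum _ _ _ (lt_top_iff_ne_top.2 htop) fun i _ => ?_
    rw [← smul_sub]
    by_cases hc : c i = 0
    · rw [hc, zero_smul, hα.map_zero]
      exact lt_top_iff_ne_top.2 htop
    · have hle : α (∑ i, c i • e i) ≤ α (c i • e i) := by
        rw [he c]
        exact Finset.inf_le (f := fun i => α (c i • e i)) (Finset.mem_univ i)
      refine hle.trans_lt ?_
      rw [hα.map_smul, hα.map_smul]
      exact WithTop.add_lt_add_right (fun ht => hc ((v.top_iff).1 ht)) (h i)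

variable {K : Type*} [Field K] [Algebra F K] {vK : AddValuation K (WithTop Γ)}

theorem restrict {α : K ⊗[F] V → WithTop Γ} (hα : IsValueFunction vK α)
    (hK : ∀ a : F, vK (algebraMap F K a) = v a) : IsValueFunction v (restrict α) where
  eq_top_iff x := by
    rw [NormDescent.restrict, hα.eq_top_iff]
    constructor
    · intro h
      exact Module.FaithfullyFlat.tensorProduct_mk_injective (A := F) (B := K) V
        (h.trans (TensorProduct.tmul_zero V (1 : K)).symm)
    · rintro rfl
      exact TensorProduct.tmul_zero _ _
  min_le_add x y := by
    rw [NormDescent.restrict, NormDescent.restrict, NormDescent.restrict, TensorProduct.tmul_add]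
    exact hα.min_le_add _ _
  map_smul c x := by
    rw [NormDescent.restrict, NormDescent.restrict, TensorProduct.tmul_smul,
      ← algebraMap_smul K c, hα.map_smul, hK]

end IsValueFunction

variable {K : Type*} [Field K] [Algebra F K] {v : AddValuation F (WithTop Γ)}
  {vK : AddValuation K (WithTop Γ)}

/-- If the coordinates of a splitting base in a base of `V` can be approximated by elements of `F`,
then the norm descends. -/
theorem exists_isNorm_restrict_of_approx (hK : ∀ a : F, vK (algebraMap F K a) = v a)
    {α : K ⊗[F] V → WithTop Γ} (hα : IsValueFunction vK α) {n : ℕ}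
    (e : Module.Basis (Fin n) K (K ⊗[F] V)) (he : IsSplittingBase α e) {ι : Type*} [Fintype ι]
    (b : Module.Basis ι F V)
    (happ : ∀ i j, ∃ c : F, α (e i) < restrict α (b j) +
      vK ((Algebra.TensorProduct.basis K b).repr (e i) j - algebraMap F K c)) :
    ∃ h : IsNorm v (restrict α), α = tensorNorm h vK := by
  choose c hc using happ
  let e' : Fin n → V := fun i => ∑ j, c i j • b j
  have hclose : ∀ i, α (e i) < α (e i - 1 ⊗ₜ[F] e' i) := by
    intro i
    have hsub : e i - 1 ⊗ₜ[F] e' i = ∑ j, ((Algebra.TensorProduct.basis K b).repr (e i) j -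
        algebraMap F K (c i j)) • (1 ⊗ₜ[F] b j : K ⊗[F] V) := by
      conv_lhs => rw [← (Algebra.TensorProduct.basis K b).sum_repr (e i)]
      simp only [e', TensorProduct.tmul_sum, ← Finset.sum_sub_distrib]
      refine Finset.sum_congr rfl fun j _ => ?_
      refine Eq.trans ?_ (sub_smul _ _ (1 ⊗ₜ[F] b j : K ⊗[F] V)).symm
      rw [algebraMap_smul, Algebra.TensorProduct.basis_apply, TensorProduct.tmul_smul]
    rw [hsub]
    refine hα.lt_map_sum _ _ _ (lt_top_iff_ne_top.2 fun h => ?_) fun j _ => ?_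
    · exact e.ne_zero i ((hα.eq_top_iff _).1 h)
    · rw [hα.map_smul]
      exact hc i j
  have hsplit := hα.map_sum_smul_of_lt e he (fun i => 1 ⊗ₜ[F] e' i) hclose
  have hne : ∀ i, α (1 ⊗ₜ[F] e' i) ≠ ⊤ := by
    intro i h
    rw [hα.map_sub_lt (hclose i), hα.eq_top_iff] at h
    exact e.ne_zero i h
  have hres : ∀ a : Fin n → F, restrict α (∑ i, a i • e' i) =
      Finset.univ.inf fun i => restrict α (a i • e' i) := by
    intro a
    have := hsplit fun i => algebraMap F K (a i)
    simp only [algebraMap_smul, ← TensorProduct.tmul_smul, ← TensorProduct.tmul_sum] at this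
    exact this
  have hvr := hα.restrict (v := v) hK
  have hli : LinearIndependent F e' := by
    refine Fintype.linearIndependent_iff.2 fun a ha i => ?_
    have h1 := hres a
    rw [ha, hvr.map_zero] at h1
    have h2 : restrict α (a i • e' i) = ⊤ :=
      top_le_iff.1 (h1.le.trans (Finset.inf_le (f := fun i => restrict α (a i • e' i))
        (Finset.mem_univ i)))
    rw [hvr.eq_top_iff, smul_eq_zero] at h2
    refine h2.resolve_right fun h0 => hne i ?_
    rw [h0, TensorProduct.tmul_zero, hα.map_zero]
  -- The splitting property gave independence; counting dimensions makes the family a base of `V`.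
  have hcard : Fintype.card (Fin n) = Module.finrank F V := by
    rw [← Module.finrank_baseChange (R := K) (S := F) (M' := V), Module.finrank_eq_card_basis e]
  have : Module.Finite F V := Module.Finite.of_basis b
  let e'' : Module.Basis (Fin n) F V :=
    Module.Basis.mk hli (hli.span_eq_top_of_card_eq_finrank' hcard).ge
  have he'' : ∀ i, e'' i = e' i := fun i => Module.Basis.mk_apply hli _ i
  have hsb : IsSplittingBase (restrict α) e'' := fun a => by simpa only [he''] using hres a
  have hnorm : IsNorm v (restrict α) := ⟨hvr, n, e'', hsb⟩
  refine ⟨hnorm, ?_⟩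
  rw [tensorNorm_eq hnorm vK hK e'' hsb]
  funext x
  conv_lhs => rw [← (Algebra.TensorProduct.basis K e'').sum_repr x]
  simp only [Algebra.TensorProduct.basis_apply, he'', hsplit]
  simp only [tensorFun, hα.map_smul, he'', restrict]

end Descent
-- The required precision in the two cases
section Main

variable {Γ : Type*} [AddCommGroup Γ] [LinearOrder Γ] [IsOrderedAddMonoid Γ]

/-- With `s = α (e i)` and `t = α (b j)`, the relative precision needed for a coordinate of value
`κ` is `s - t - κ`. If this is negative, `0` is a good approximation; otherwise a bound `δ` for it
in the value group is enough. -/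
theorem IsHenselization.exists_lt_add_map_sub {F : Type u} [Field F] {K : Type*} [Field K]
    [Algebra F K] {v : AddValuation F (WithTop Γ)} {vK : AddValuation K (WithTop Γ)}
    (h : IsHenselization v vK) (k : K) (s t : Γ)
    (hd : ∀ κ : Γ, vK k = κ → 0 ≤ s - t - κ → ∃ d : F, ∃ δ : Γ, v d = δ ∧ s - t - κ ≤ δ ∧
      ∀ ρ ∈ valueGroup v, 0 < ρ → ∃ N : ℕ, δ < N • ρ) :
    ∃ c : F, (s : WithTop Γ) < t + vK (k - algebraMap F K c) := by
  have hst : ∀ x : WithTop Γ, ((s - t : Γ) : WithTop Γ) < x → (s : WithTop Γ) < t + x := by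
    intro x hx
    cases x with
    | top => simp
    | coe x =>
      norm_cast at hx ⊢
      exact sub_lt_iff_lt_add'.1 hx
  by_cases hk : ((s - t : Γ) : WithTop Γ) < vK k
  · exact ⟨0, by rw [map_zero, sub_zero]; exact hst _ hk⟩
  rw [not_lt] at hk
  obtain ⟨κ, hκ⟩ := WithTop.ne_top_iff_exists.1 (ne_top_of_le_ne_top WithTop.coe_ne_top hk)
  rw [← hκ, WithTop.coe_le_coe] at hk
  have hk0 : k ≠ 0 := by
    rintro rfl
    rw [vK.map_zero] at hκ
    exact WithTop.coe_ne_top hκ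
  obtain ⟨d, δ, hdδ, hle, hN⟩ := hd κ hκ.symm (sub_nonneg.2 hk)
  have hd0 : d ≠ 0 := by
    rintro rfl
    rw [v.map_zero] at hdδ
    exact WithTop.top_ne_coe hdδ
  obtain ⟨c, hc⟩ := h.exists_lt_map_sub hk0 hd0
    (by rw [hdδ, WithTop.coe_nonneg]; exact (sub_nonneg.2 hk).trans hle)
    (fun a ha => by
      rw [hdδ]
      by_cases hat : v a = ⊤
      · refine ⟨1, ?_⟩
        rw [hat, one_smul]
        exact WithTop.coe_lt_top _
      · obtain ⟨ρ, hρ⟩ := WithTop.ne_top_iff_exists.1 hat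
        rw [← hρ, WithTop.coe_pos] at ha
        obtain ⟨N, hN⟩ := hN ρ ⟨a, hρ.symm⟩ ha
        refine ⟨N, ?_⟩
        rw [← hρ, ← WithTop.coe_nsmul, WithTop.coe_lt_coe]
        exact hN)
  refine ⟨c, hst _ (lt_of_le_of_lt ?_ hc)⟩
  rw [← hκ, hdδ, ← WithTop.coe_add, WithTop.coe_le_coe]
  exact sub_le_iff_le_add'.1 hle

/-- A Henselization has the same value group. -/
theorem IsHenselization.mem_valueGroup {F : Type u} [Field F] {K : Type*} [Field K]
    [Algebra F K] {v : AddValuation F (WithTop Γ)} {vK : AddValuation K (WithTop Γ)}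
    (h : IsHenselization v vK) {k : K} {κ : Γ} (hκ : vK k = κ) : κ ∈ valueGroup v := by
  have hk0 : k ≠ 0 := by
    rintro rfl
    rw [vK.map_zero] at hκ
    exact WithTop.top_ne_coe hκ
  -- Precision `d = 1` already forces `c` and `k` to have the same value.
  obtain ⟨c, hc⟩ := h.exists_lt_map_sub hk0 one_ne_zero (by rw [v.map_one])
    (fun a ha => ⟨1, by rwa [v.map_one, one_smul]⟩)
  refine ⟨c, ?_⟩
  rw [v.map_one, add_zero] at hc
  rw [← h.map_eq, ← hκ]
  have h1 := vK.map_add_eq_of_lt_left (x := k) (y := -(k - algebraMap F K c))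
    (by rwa [vK.map_neg])
  rwa [neg_sub, add_sub_cancel] at h1

theorem exists_mem_le_of_mem_divisibleHull {H : AddSubgroup Γ} {x : Γ} (hx : x ∈ divisibleHull H)
    (hx0 : 0 ≤ x) : ∃ n : ℕ, n • x ∈ H ∧ x ≤ n • x := by
  obtain ⟨n, hn, hmem⟩ := hx
  refine ⟨n, hmem, ?_⟩
  conv_lhs => rw [← one_smul ℕ x]
  exact nsmul_le_nsmul_left hx0 hn

theorem ConvexSubgroup.εTop_coe {G : Type*} [AddCommGroup G] [LinearOrder G]
    (Δ : ConvexSubgroup G) (x : G) : Δ.εTop (x : WithTop G) = (Δ.ε x : WithTop Δ.Quo) := rfl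

/-- For a base of `V` splitting the coarse norm, `β (e i)` is at most the coarse value of each term
of `e i`. So a nonnegative precision `s - t - κ` is bounded by an element of `Δ`, hence lies in `Δ`,
and some multiple of it is a value of `F`. -/
theorem exists_isNorm_restrict_of_coarsening {F : Type u} [Field F] {v : AddValuation F (WithTop Γ)}
    {K : Type*} [Field K] [Algebra F K] {vK : AddValuation K (WithTop Γ)}
    (h : IsHenselization v vK) {V : Type*} [AddCommGroup V] [Module F V]
    {α : K ⊗[F] V → WithTop Γ} (hα : IsNorm vK α) (hΓ : divisibleHull (valueGroup v) = ⊤)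
    (Δ : ConvexSubgroup Γ) (hΔ : rank Δ.toAddSubgroup = 1)
    (hβ : IsNorm (Δ.coarsen v) (restrict (Δ.εTop ∘ α)))
    (heq : Δ.εTop ∘ α = tensorNorm hβ (Δ.coarsen vK)) :
    ∃ h : IsNorm v (restrict α), α = tensorNorm h vK := by
  obtain ⟨hαv, n, e, he⟩ := hα
  obtain ⟨m, b, hb⟩ := hβ.2
  rw [tensorNorm_eq hβ _ (fun a => by
    rw [ConvexSubgroup.coarsen_apply, ConvexSubgroup.coarsen_apply, h.map_eq]) b hb] at heq
  refine exists_isNorm_restrict_of_approx h.map_eq hαv e he b fun i j => ?_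
  obtain ⟨s, hs⟩ := WithTop.ne_top_iff_exists.1 fun h => e.ne_zero i ((hαv.eq_top_iff _).1 h)
  obtain ⟨t, ht⟩ := WithTop.ne_top_iff_exists.1 fun h' =>
    b.ne_zero j (((hαv.restrict h.map_eq).eq_top_iff _).1 h')
  rw [← hs, ← ht]
  refine h.exists_lt_add_map_sub _ s t fun κ hκ hpos => ?_
  have hle : Δ.εTop (α (e i)) ≤ Δ.εTop (restrict α (b j)) +
      Δ.coarsen vK ((Algebra.TensorProduct.basis K b).repr (e i) j) := by
    have := congrFun heq (e i)
    rw [Function.comp_apply] at this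
    rw [this]
    exact Finset.inf_le (f := fun j => restrict (Δ.εTop ∘ α) (b j) +
      Δ.coarsen vK ((Algebra.TensorProduct.basis K b).repr (e i) j)) (Finset.mem_univ j)
  rw [← hs, ← ht, ConvexSubgroup.coarsen_apply, hκ, ← map_add, ← WithTop.coe_add,
    ConvexSubgroup.εTop_coe, ConvexSubgroup.εTop_coe, WithTop.coe_le_coe,
    ConvexSubgroup.ε_le_iff] at hle
  obtain ⟨δ, hδ, hle⟩ := hle
  have hmem : s - t - κ ∈ Δ.toAddSubgroup :=
    Δ.convex' _ δ hpos (by rwa [sub_sub, sub_le_iff_le_add']) hδ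
  obtain ⟨N, ⟨d, hd⟩, hN⟩ := exists_mem_le_of_mem_divisibleHull
    (hΓ ▸ AddSubgroup.mem_top (s - t - κ)) hpos
  have hNΔ : N • (s - t - κ) ∈ Δ.toAddSubgroup := Δ.nsmul_mem hmem N
  refine ⟨d, _, hd, hN, fun ρ _ hρ => ?_⟩
  -- Inside `Δ` the archimedean property applies; a positive element outside `Δ` exceeds all of `Δ`.
  by_cases hρΔ : ρ ∈ Δ.toAddSubgroup
  · obtain ⟨M, hM⟩ := exists_lt_nsmul_of_rank_eq_one hΔ ⟨_, hNΔ⟩ ⟨ρ, hρΔ⟩ hρ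
    exact ⟨M, hM⟩
  · refine ⟨1, ?_⟩
    rw [one_smul]
    by_contra! hcon
    exact hρΔ (Δ.convex' _ _ hρ.le hcon hNΔ)

/-- The shift `γ` cancels in `s - t`, so the precision lies in the divisible hull. Any base of `V`
works, since the value group is archimedean. -/
theorem exists_isNorm_restrict_of_rank_eq_one {F : Type u} [Field F]
    {v : AddValuation F (WithTop Γ)} {K : Type*} [Field K] [Algebra F K]
    {vK : AddValuation K (WithTop Γ)} (h : IsHenselization v vK) {V : Type*} [AddCommGroup V]
    [Module F V] [FiniteDimensional F V] {α : K ⊗[F] V → WithTop Γ} (hα : IsNorm vK α)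
    (hv : rank (valueGroup v) = 1) (γ : Γ)
    (hγ : ∀ x, x ≠ 0 → ∃ δ ∈ divisibleHull (valueGroup v), α x = ((γ + δ : Γ) : WithTop Γ)) :
    ∃ h : IsNorm v (restrict α), α = tensorNorm h vK := by
  obtain ⟨hαv, n, e, he⟩ := hα
  let b := Module.finBasis F V
  refine exists_isNorm_restrict_of_approx h.map_eq hαv e he b fun i j => ?_
  obtain ⟨s, hsmem, hs⟩ := hγ (e i) (e.ne_zero i)
  obtain ⟨t, htmem, ht⟩ := hγ (1 ⊗ₜ[F] b j)
    (by rw [← Algebra.TensorProduct.basis_apply]; exact Module.Basis.ne_zero _ j)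
  rw [hs, restrict, ht]
  refine h.exists_lt_add_map_sub _ _ _ fun κ hκ hpos => ?_
  rw [add_sub_add_left_eq_sub] at hpos ⊢
  have hκmem : κ ∈ divisibleHull (valueGroup v) :=
    ⟨1, one_pos, by rw [one_smul]; exact h.mem_valueGroup hκ⟩
  obtain ⟨N, hmem, hN⟩ := exists_mem_le_of_mem_divisibleHull
    (sub_mem (sub_mem hsmem htmem) hκmem) hpos
  obtain ⟨d, hd⟩ := hmem
  refine ⟨d, _, hd, hN, fun ρ hρmem hρ => ?_⟩
  obtain ⟨M, hM⟩ := exists_lt_nsmul_of_rank_eq_one hv ⟨_, ⟨d, hd⟩⟩ ⟨ρ, hρmem⟩ hρ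
  exact ⟨M, hM⟩

end Main

end NormDescent

theorem mainTheorem10
    {Γ : Type*} [AddCommGroup Γ] [LinearOrder Γ] [IsOrderedAddMonoid Γ]
    (hdiv : ∀ n : ℕ, n ≠ 0 → ∀ γ : Γ, ∃ δ : Γ, n • δ = γ)
    {F : Type u} [Field F] (v : AddValuation F (WithTop Γ))
    {Fh : Type*} [Field Fh] [Algebra F Fh] (vh : AddValuation Fh (WithTop Γ))
    (hh : NormDescent.IsHenselization v vh)
    {V : Type*} [AddCommGroup V] [Module F V] [FiniteDimensional F V]
    (α : Fh ⊗[F] V → WithTop Γ) (hα : NormDescent.IsNorm vh α) :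
    (NormDescent.divisibleHull (NormDescent.valueGroup v) = ⊤ →
      ∀ Δ : NormDescent.ConvexSubgroup Γ, NormDescent.rank Δ.toAddSubgroup = 1 →
      ∀ hβ : NormDescent.IsNorm (Δ.coarsen v) (NormDescent.restrict (Δ.εTop ∘ α)),
        Δ.εTop ∘ α = NormDescent.tensorNorm hβ (Δ.coarsen vh) →
        ∃ h : NormDescent.IsNorm v (NormDescent.restrict α),
          α = NormDescent.tensorNorm h vh) ∧
    (NormDescent.rank (NormDescent.valueGroup v) = 1 →
      ∀ γ : Γ, (∀ x, x ≠ 0 → ∃ δ ∈ NormDescent.divisibleHull (NormDescent.valueGroup v),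
          α x = ((γ + δ : Γ) : WithTop Γ)) →
        ∃ h : NormDescent.IsNorm v (NormDescent.restrict α),
          α = NormDescent.tensorNorm h vh) := by
  exact ⟨fun hΓ Δ hΔ hβ heq =>
    NormDescent.exists_isNorm_restrict_of_coarsening hh hα hΓ Δ hΔ hβ heq,
    fun hv γ hγ => NormDescent.exists_isNorm_restrict_of_rank_eq_one hh hα hv γ hγ⟩
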